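/- Notation. For a function $\varphi$ on $[0,\infty)$ put $(F\varphi)(r)=\varphi(\sqrt{2r})$ and $(F^{-1}\varphi)(r)=\varphi(r^2/2)$. Let $I_0\varphi=\varphi$; for $\nu>0$ let $I_\nu\varphi(r)=\int_r^\infty\frac{(x-r)^{\nu-1}}{\Gamma(\nu)}\varphi(x)\,dx$, and let $I_{-\nu}\varphi=I_{n-\nu}\big((-1)^n\varphi^{(n)}\big)$ with $n=\lceil\nu\rceil$, the derivatives being taken on $[0,\infty)$ (one-sided at $0$). Write $x_+^p=x^p$ for $x\ge 0$ and $x_+^p=0$ for $x<0$. With $f_\ell(x)=(1-x^2)_+^\ell$ on $\mathbb R$ and $*$ the convolution on $\mathbb R$, the generalized Wu function is $$\varphi_{\ell,k}(r)=\mathscr D^k(f_\ell*f_\ell)(r),\qquad \mathscr D^k=F^{-1}I_{-k}F,\qquad r\ge 0.$$ The generalized Wendland functions are $\psi^{wd}_{\mu,0}(r)=(1-r)_+^\mu$ and, for $\alpha>0$, $$\psi^{wd}_{\mu,\alpha}(r)=\int_r^1\frac{t\,(1-t)^\mu\,(t^2-r^2)^{\alpha-1}}{\Gamma(\alpha)\,2^{\alpha-1}}\,dt\quad(0\le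 r\le 1),\qquad \psi^{wd}_{\mu,\alpha}(r)=0\quad(r>1).$$ Theorem. Let $\ell\in\mathbb N=\{0,1,2,\dots\}$ and $k\in\{0,\tfrac12,1,\tfrac32,\dots\}$ with $k\le\ell$. Then for all $r\ge 0$ $$\varphi_{\ell,k}(2r)=2^{3\ell-2k+1}\,\Gamma(\ell+1)\sum_{n=0}^{\ell}\binom{\ell}{n}\frac{1}{\ell+n+1}\,2^{\ell-n}(-1)^n\,\psi^{wd}_{\ell+n+1,\,\ell-k}(r).$$ -/

import Mathlib

open MeasureTheory
open scoped Convolution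

noncomputable section

/-- The truncated power `x_+ ^ p`: it is `x ^ p` for `x ≥ 0` and `0` for `x < 0`.
In particular `x_+ ^ 0` is the indicator function of `[0, ∞)`. -/
def truncPow (x p : ℝ) : ℝ := if 0 ≤ x then x ^ p else 0

/-- The `f`-form `r ↦ φ(√(2r))` of a function on `[0, ∞)`. -/
def fForm (φ : ℝ → ℝ) (r : ℝ) : ℝ := φ (Real.sqrt (2 * r))

/-- The inverse `f`-form `r ↦ φ(r² / 2)` of a function on `[0, ∞)`. -/
def fFormInv (φ : ℝ → ℝ) (r : ℝ) : ℝ := φ (r ^ 2 / 2)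

/-- The fractional integral of order `ν ≥ 0`: the identity for `ν = 0`, and
`r ↦ ∫_r^∞ (x - r)^(ν - 1) / Γ(ν) φ(x) dx` for `ν > 0`. -/
def fracIntegral (ν : ℝ) (φ : ℝ → ℝ) (r : ℝ) : ℝ :=
  if ν = 0 then φ r
  else ∫ x in Set.Ioi r, (x - r) ^ (ν - 1) / Real.Gamma ν * φ x

/-- The operator `I_ν` on functions on `[0, ∞)`: the fractional integral for `ν ≥ 0`, and for
`ν < 0` the fractional derivative `I_ν = I_(n + ν) ∘ (-1)^n dⁿ/drⁿ` with `n = ⌈-ν⌉`.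
Derivatives are taken within `[0, ∞)`, hence one-sided at `0`. -/
def fracOp (ν : ℝ) (φ : ℝ → ℝ) : ℝ → ℝ :=
  if 0 ≤ ν then fracIntegral ν φ
  else fracIntegral (⌈-ν⌉₊ + ν)
    (fun r => (-1) ^ ⌈-ν⌉₊ * iteratedDerivWithin ⌈-ν⌉₊ φ (Set.Ici 0) r)

/-- The operator `𝒟^k`, the conjugate of `I_(-k)` by the `f`-form. -/
def dimWalkD (k : ℝ) (φ : ℝ → ℝ) : ℝ → ℝ := fFormInv (fracOp (-k) (fForm φ))

/-- The function `f_ℓ(x) = (1 - x²)_+ ^ ℓ` on the real line. -/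
def wuBase (ℓ : ℝ) (x : ℝ) : ℝ := truncPow (1 - x ^ 2) ℓ

/-- The generalized Wu function `φ_{ℓ,k} = 𝒟^k (f_ℓ * f_ℓ)`, with the convolution on `ℝ`. -/
def wuFunction (ℓ k : ℝ) : ℝ → ℝ :=
  dimWalkD k (wuBase ℓ ⋆[ContinuousLinearMap.mul ℝ ℝ, volume] wuBase ℓ)

/-- The generalized Wendland function `ψ_{μ,α}`: for `α = 0` it is Askey's truncated power
`(1 - r)_+ ^ μ`, and for `α > 0` it is
`∫_r^1 t (1 - t)^μ (t² - r²)^(α - 1) / (Γ(α) 2^(α - 1)) dt` on `0 ≤ r ≤ 1` and `0` for `r > 1`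
(where the domain of integration below is empty). -/
def wendlandFunction (μ α : ℝ) (r : ℝ) : ℝ :=
  if α = 0 then truncPow (1 - r) μ
  else ∫ t in Set.Ioc r 1,
    t * (1 - t) ^ μ * (t ^ 2 - r ^ 2) ^ (α - 1) / (Real.Gamma α * 2 ^ (α - 1))

end

/-! The `f`-form of `f_ℓ * f_ℓ` is `I_ℓ g` for an explicit continuous `g` (`wuProfile`) vanishing on
`[2, ∞)`. Hence `I_(-k)` turns it into `I_(ℓ-k) g` (`fracOp_neg_eq_of_iterate_tailIntegral`). Now
`g` is a combination of `f`-forms of dilated Askey functions, and `I_α` maps each of these to a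
Wendland function (`fracIntegral_askeyForm`). To find `g`, a Landen-type substitution rewrites the
convolution at `r` as `∫_r^2 (t² - r²)^ℓ (1 - t²/4)^ℓ dt` (`integral_symm_eq_integral_tail`). With
`x = t²/2` and one integration by parts this is `I_ℓ g` at `r²/2`, where `g(t²/2)` is the primitive
of `-2^ℓ ℓ! (1 - t²/4)^ℓ` vanishing at `t = 2`. Expanding in powers of `1 - t/2` gives the binomial
sum. -/

/-! ### Fractional integrals of compactly supported functions -/

/-- The integral of `g` from `s` to a fixed endpoint `c`; for `g` vanishing on `[c, ∞)` it is the
fractional integral of order one. -/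
noncomputable def tailIntegral (c : ℝ) (g : ℝ → ℝ) (s : ℝ) : ℝ := ∫ x in s..c, g x

theorem hasDerivAt_tailIntegral (c : ℝ) {g : ℝ → ℝ} (hg : Continuous g) (s : ℝ) :
    HasDerivAt (tailIntegral c g) (-g s) s :=
  intervalIntegral.integral_hasDerivAt_left (hg.intervalIntegrable _ _)
    hg.stronglyMeasurable.stronglyMeasurableAtFilter hg.continuousAt

theorem continuous_tailIntegral (c : ℝ) {g : ℝ → ℝ} (hg : Continuous g) :
    Continuous (tailIntegral c g) :=
  continuous_iff_continuousAt.2 fun s => (hasDerivAt_tailIntegral c hg s).continuousAt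

theorem tailIntegral_eq_zero {c : ℝ} {g : ℝ → ℝ} (h0 : ∀ x, c ≤ x → g x = 0) (s : ℝ)
    (hs : c ≤ s) : tailIntegral c g s = 0 := by
  unfold tailIntegral
  rw [intervalIntegral.integral_congr (g := fun _ => (0 : ℝ)), intervalIntegral.integral_zero]
  intro x hx
  rw [Set.uIcc_of_ge hs] at hx
  exact h0 x hx.1

theorem continuous_iterate_tailIntegral (c : ℝ) {g : ℝ → ℝ} (hg : Continuous g) (j : ℕ) :
    Continuous ((tailIntegral c)^[j] g) := by
  induction j with
  | zero => exact hg
  | succ j ih =>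
    rw [Function.iterate_succ_apply']
    exact continuous_tailIntegral c ih

theorem iterate_tailIntegral_eq_zero {c : ℝ} {g : ℝ → ℝ} (h0 : ∀ x, c ≤ x → g x = 0) (j : ℕ) :
    ∀ s, c ≤ s → (tailIntegral c)^[j] g s = 0 := by
  induction j with
  | zero => exact h0
  | succ j ih =>
    rw [Function.iterate_succ_apply']
    exact tailIntegral_eq_zero ih

theorem fracIntegral_eq_Ioc {c a : ℝ} (ha : a ≠ 0) {g : ℝ → ℝ} (h0 : ∀ x, c ≤ x → g x = 0)
    (r : ℝ) :
    fracIntegral a g r = ∫ x in Set.Ioc r c, (x - r) ^ (a - 1) / Real.Gamma a * g x := by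
  rw [fracIntegral, if_neg ha]
  refine setIntegral_eq_of_subset_of_forall_sdiff_eq_zero measurableSet_Ioi
    Set.Ioc_subset_Ioi_self ?_
  rintro x ⟨hx, hx'⟩
  rw [h0 x, mul_zero]
  by_contra h
  exact hx' ⟨hx, (not_le.1 h).le⟩

theorem fracIntegral_eq_zero {c : ℝ} (a : ℝ) {g : ℝ → ℝ} (h0 : ∀ x, c ≤ x → g x = 0)
    (r : ℝ) (hr : c ≤ r) : fracIntegral a g r = 0 := by
  by_cases ha : a = 0
  · rw [fracIntegral, if_pos ha, h0 r hr]
  · rw [fracIntegral_eq_Ioc ha h0, Set.Ioc_eq_empty (not_lt.2 hr), setIntegral_empty]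

theorem intervalIntegrable_sub_rpow {p : ℝ} (hp : -1 < p) (r a b : ℝ) :
    IntervalIntegrable (fun x => (x - r) ^ p) volume a b := by
  have := (intervalIntegral.intervalIntegrable_rpow' (a := a - r) (b := b - r) hp).comp_sub_right r
  simpa using this

theorem intervalIntegrable_fracKernel_mul {a : ℝ} (ha : 0 < a) {g : ℝ → ℝ} (hg : Continuous g)
    (r s t : ℝ) :
    IntervalIntegrable (fun x => (x - r) ^ (a - 1) / Real.Gamma a * g x) volume s t :=
  ((intervalIntegrable_sub_rpow (by linarith) r s t).div_const _).mul_continuousOn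
    hg.continuousOn

/-- Integration by parts: the tail vanishes at `c` and `(x - r)^a` vanishes at `r`, so no boundary
term survives when `a > 0`. -/
theorem fracIntegral_tailIntegral {c a : ℝ} (ha : 0 ≤ a) {g : ℝ → ℝ} (hg : Continuous g)
    (h0 : ∀ x, c ≤ x → g x = 0) (r : ℝ) :
    fracIntegral a (tailIntegral c g) r = fracIntegral (a + 1) g r := by
  rcases le_or_gt c r with hr | hr
  · rw [fracIntegral_eq_zero a (tailIntegral_eq_zero h0) r hr, fracIntegral_eq_zero _ h0 r hr]
  rw [fracIntegral_eq_Ioc (by positivity) h0, ← intervalIntegral.integral_of_le hr.le]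
  rcases ha.eq_or_lt with rfl | ha
  · simp [fracIntegral, tailIntegral]
  rw [fracIntegral_eq_Ioc ha.ne' (tailIntegral_eq_zero h0),
    ← intervalIntegral.integral_of_le hr.le]
  have hΓ : Real.Gamma a ≠ 0 := (Real.Gamma_pos_of_pos ha).ne'
  have hG : Real.Gamma (a + 1) = a * Real.Gamma a := Real.Gamma_add_one ha.ne'
  have key := intervalIntegral.integral_mul_deriv_eq_deriv_mul_of_hasDeriv_right
    (a := r) (b := c) (u := tailIntegral c g) (u' := fun x => -g x)
    (v := fun x => (x - r) ^ a / Real.Gamma (a + 1))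
    (v' := fun x => (x - r) ^ (a - 1) / Real.Gamma a)
    (continuous_tailIntegral c hg).continuousOn
    (((continuous_id.sub continuous_const).rpow_const fun _ => Or.inr ha.le).div_const
      _).continuousOn
    (fun x _ => (hasDerivAt_tailIntegral c hg x).hasDerivWithinAt) ?_
    (hg.neg.intervalIntegrable _ _)
    ((intervalIntegrable_sub_rpow (by linarith) r r c).div_const _)
  · simp only [tailIntegral_eq_zero h0 c le_rfl, sub_self, Real.zero_rpow ha.ne', zero_div,
      mul_zero, zero_mul, zero_sub, neg_mul, intervalIntegral.integral_neg, neg_neg] at key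
    simp only [add_sub_cancel_right]
    rw [intervalIntegral.integral_congr fun x _ => mul_comm _ _, key]
    exact intervalIntegral.integral_congr fun x _ => mul_comm _ _
  · intro x hx
    rw [min_eq_left hr.le] at hx
    have hne : x - r ≠ 0 := (sub_pos.2 hx.1).ne'
    have := (((hasDerivAt_id x).sub_const r).rpow_const (p := a) (Or.inl hne)).div_const
      (Real.Gamma (a + 1))
    refine (this.congr_deriv ?_).hasDerivWithinAt
    rw [hG]
    simp only [id]
    field_simp

theorem fracIntegral_iterate_tailIntegral {c : ℝ} {g : ℝ → ℝ} (hg : Continuous g)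
    (h0 : ∀ x, c ≤ x → g x = 0) (r : ℝ) (j : ℕ) :
    ∀ {a : ℝ}, 0 ≤ a → fracIntegral a ((tailIntegral c)^[j] g) r = fracIntegral (a + j) g r := by
  induction j with
  | zero => intro a _; simp
  | succ j ih =>
    intro a ha
    rw [Function.iterate_succ_apply', fracIntegral_tailIntegral ha
      (continuous_iterate_tailIntegral c hg j) (iterate_tailIntegral_eq_zero h0 j),
      ih (by positivity)]
    congr 1
    push_cast
    ring

theorem iterate_tailIntegral_eq_fracIntegral {c : ℝ} {g : ℝ → ℝ} (hg : Continuous g)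
    (h0 : ∀ x, c ≤ x → g x = 0) (r : ℝ) (j : ℕ) :
    (tailIntegral c)^[j] g r = fracIntegral j g r := by
  have := fracIntegral_iterate_tailIntegral hg h0 r j le_rfl
  rwa [zero_add, fracIntegral, if_pos rfl] at this

theorem iteratedDerivWithin_iterate_tailIntegral (c : ℝ) {g : ℝ → ℝ} (hg : Continuous g)
    (j n : ℕ) : ∀ s, 0 ≤ s →
      iteratedDerivWithin n ((tailIntegral c)^[j + n] g) (Set.Ici 0) s =
        (-1) ^ n * (tailIntegral c)^[j] g s := by
  induction n generalizing j with
  | zero => intro s _; simp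
  | succ n ih =>
    intro s hs
    rw [iteratedDerivWithin_succ]
    have h1 : j + (n + 1) = (j + 1) + n := by ring
    have h2 : Set.EqOn (iteratedDerivWithin n ((tailIntegral c)^[j + 1 + n] g) (Set.Ici 0))
        (fun x => (-1) ^ n * (tailIntegral c)^[j + 1] g x) (Set.Ici 0) := ih (j + 1)
    rw [h1, derivWithin_congr h2 (h2 hs)]
    have := (hasDerivAt_tailIntegral c (continuous_iterate_tailIntegral c hg j) s).const_mul
      ((-1 : ℝ) ^ n)
    rw [← Function.iterate_succ_apply' (tailIntegral c)] at this
    rw [this.hasDerivWithinAt.derivWithin (uniqueDiffOn_Ici 0 s hs)]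
    ring

theorem fracIntegral_congr (a : ℝ) {g g' : ℝ → ℝ} {r : ℝ} (h : ∀ x, r ≤ x → g x = g' x) :
    fracIntegral a g r = fracIntegral a g' r := by
  unfold fracIntegral
  rw [h r le_rfl]
  congr 1
  refine setIntegral_congr_fun measurableSet_Ioi fun x hx => ?_
  simp only [h x (le_of_lt hx)]

/-- Differentiating `⌈k⌉` times strips that many tail integrals; the remaining `m - ⌈k⌉` add to the
fractional order `⌈k⌉ - k`. Continuity of `g` suffices, since `g` itself is never differentiated. -/
theorem fracOp_neg_eq_of_iterate_tailIntegral {c : ℝ} {g φ : ℝ → ℝ} (hg : Continuous g)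
    (h0 : ∀ x, c ≤ x → g x = 0) {m : ℕ} (hφ : ∀ s, 0 ≤ s → φ s = (tailIntegral c)^[m] g s)
    {k : ℝ} (hk : 0 ≤ k) (hkm : k ≤ m) {r : ℝ} (hr : 0 ≤ r) :
    fracOp (-k) φ r = fracIntegral (m - k) g r := by
  rcases hk.eq_or_lt with rfl | hk
  · simp only [fracOp, neg_zero, le_refl, if_true, sub_zero]
    rw [← iterate_tailIntegral_eq_fracIntegral hg h0, ← hφ r hr, fracIntegral, if_pos rfl]
  · rw [fracOp, if_neg (by linarith), neg_neg]
    obtain ⟨j, rfl⟩ := Nat.exists_eq_add_of_le' (Nat.ceil_le.2 hkm)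
    rw [fracIntegral_congr (g' := (tailIntegral c)^[j] g), fracIntegral_iterate_tailIntegral hg h0]
    · congr 1
      push_cast
      ring
    · linarith [Nat.le_ceil k]
    · intro x hx
      have hφ' : Set.EqOn φ ((tailIntegral c)^[j + ⌈k⌉₊] g) (Set.Ici 0) := hφ
      rw [iteratedDerivWithin_congr hφ' (Set.mem_Ici.2 (hr.trans hx)),
        iteratedDerivWithin_iterate_tailIntegral c hg j _ x (hr.trans hx), ← mul_assoc,
        ← mul_pow]
      simp

theorem fracIntegral_sum {ι : Type*} (s : Finset ι) {c a : ℝ} (ha : 0 ≤ a) (w : ι → ℝ)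
    {g : ι → ℝ → ℝ} (hg : ∀ i ∈ s, Continuous (g i)) (h0 : ∀ i ∈ s, ∀ x, c ≤ x → g i x = 0)
    (r : ℝ) :
    fracIntegral a (fun x => ∑ i ∈ s, w i * g i x) r = ∑ i ∈ s, w i * fracIntegral a (g i) r := by
  rcases ha.eq_or_lt with rfl | ha
  · simp [fracIntegral]
  have hs : ∀ x, c ≤ x → ∑ i ∈ s, w i * g i x = 0 := fun x hx =>
    Finset.sum_eq_zero fun i hi => by rw [h0 i hi x hx, mul_zero]
  rcases le_or_gt c r with hr | hr
  · rw [fracIntegral_eq_zero a hs r hr, Finset.sum_eq_zero]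
    intro i hi
    rw [fracIntegral_eq_zero a (h0 i hi) r hr, mul_zero]
  rw [fracIntegral_eq_Ioc ha.ne' hs, ← intervalIntegral.integral_of_le hr.le]
  simp_rw [Finset.mul_sum]
  rw [intervalIntegral.integral_finsetSum]
  · refine Finset.sum_congr rfl fun i hi => ?_
    rw [fracIntegral_eq_Ioc ha.ne' (h0 i hi), ← intervalIntegral.integral_of_le hr.le,
      ← intervalIntegral.integral_const_mul]
    exact intervalIntegral.integral_congr fun x _ => by ring
  · intro i hi
    exact intervalIntegrable_fracKernel_mul ha (continuous_const.mul (hg i hi)) r r c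

/-! ### The self-convolution of `wuBase` -/

theorem wuBase_of_abs_le {ℓ : ℕ} {x : ℝ} (hx : |x| ≤ 1) : wuBase ℓ x = (1 - x ^ 2) ^ ℓ := by
  rw [wuBase, truncPow, if_pos, Real.rpow_natCast]
  have := (sq_le_one_iff_abs_le_one x).2 hx
  linarith

theorem wuBase_of_one_lt_abs {ℓ : ℝ} {x : ℝ} (hx : 1 < |x|) : wuBase ℓ x = 0 := by
  rw [wuBase, truncPow, if_neg]
  have := (one_lt_sq_iff_one_lt_abs x).2 hx
  linarith

theorem wuBase_convolution_of_two_lt {ℓ : ℝ} {r : ℝ} (hr : 2 < r) :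
    (wuBase ℓ ⋆[ContinuousLinearMap.mul ℝ ℝ, volume] wuBase ℓ) r = 0 := by
  rw [convolution_def, ← integral_zero ℝ ℝ (μ := volume)]
  congr 1
  funext t
  simp only [ContinuousLinearMap.mul_apply']
  rcases lt_or_ge 1 |t| with h | h
  · rw [wuBase_of_one_lt_abs h, zero_mul]
  · rw [wuBase_of_one_lt_abs (x := r - t), mul_zero]
    rw [abs_le] at h
    exact lt_of_lt_of_le (by linarith) (le_abs_self _)

/-- Shifting the variable to the midpoint `r / 2` of the overlap of the two supports makes the
integrand even. -/
theorem wuBase_convolution_eq_symm (ℓ : ℕ) {r : ℝ} (hr : 0 ≤ r) (hr2 : r ≤ 2) :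
    (wuBase ℓ ⋆[ContinuousLinearMap.mul ℝ ℝ, volume] wuBase ℓ) r =
      ∫ y in -(1 - r / 2)..(1 - r / 2),
        (((1 - r / 2) ^ 2 - y ^ 2) * ((1 + r / 2) ^ 2 - y ^ 2)) ^ ℓ := by
  rw [convolution_def, ← integral_add_right_eq_self _ (r / 2),
    intervalIntegral.integral_of_le (by linarith), ← integral_Icc_eq_integral_Ioc,
    ← setIntegral_eq_integral_of_forall_compl_eq_zero
      (s := Set.Icc (-(1 - r / 2)) (1 - r / 2))]
  · refine setIntegral_congr_fun measurableSet_Icc fun y hy => ?_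
    simp only [ContinuousLinearMap.mul_apply']
    rw [wuBase_of_abs_le, wuBase_of_abs_le, ← mul_pow]
    · ring
    · rw [abs_le]; constructor <;> linarith [hy.1, hy.2]
    · rw [abs_le]; constructor <;> linarith [hy.1, hy.2]
  · intro y hy
    simp only [ContinuousLinearMap.mul_apply']
    rw [Set.mem_Icc, not_and_or, not_le, not_le] at hy
    rcases hy with h | h
    · rw [wuBase_of_one_lt_abs (x := r - _), mul_zero]
      exact lt_of_lt_of_le (by linarith) (le_abs_self _)
    · rw [wuBase_of_one_lt_abs (x := y + _), zero_mul]
      exact lt_of_lt_of_le (by linarith) (le_abs_self _)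

theorem intervalIntegral_eq_zero_of_odd {f : ℝ → ℝ} (hf : ∀ x, f (-x) = -f x) (a : ℝ) :
    ∫ x in -a..a, f x = 0 := by
  have h := intervalIntegral.integral_comp_neg (a := -a) (b := a) f
  simp only [hf, neg_neg, intervalIntegral.integral_neg] at h
  linarith

/-- A Landen-type change of variables, `t = y + √(2 (1 + p²) - y²)` with `p = r / 2`; the
part of its derivative which is odd in `y` does not contribute. -/
theorem integral_symm_eq_integral_tail (ℓ : ℕ) {r : ℝ} (hr : 0 ≤ r) (hr2 : r ≤ 2) :
    ∫ y in -(1 - r / 2)..(1 - r / 2),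
        (((1 - r / 2) ^ 2 - y ^ 2) * ((1 + r / 2) ^ 2 - y ^ 2)) ^ ℓ =
      ∫ t in r..2, (t ^ 2 - r ^ 2) ^ ℓ * (1 - t ^ 2 / 4) ^ ℓ := by
  set p := r / 2 with hp
  have hrp : r = 2 * p := by rw [hp]; ring
  have hp0 : 0 ≤ p := by positivity
  have hp1 : p ≤ 1 := by linarith
  set F : ℝ → ℝ := fun y => (((1 - p) ^ 2 - y ^ 2) * ((1 + p) ^ 2 - y ^ 2)) ^ ℓ with hF
  set Q : ℝ → ℝ := fun y => √(2 * (1 + p ^ 2) - y ^ 2) with hQ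
  have hpos : ∀ y ∈ Set.uIcc (-(1 - p)) (1 - p), 0 < 2 * (1 + p ^ 2) - y ^ 2 := by
    intro y hy
    rw [Set.uIcc_of_le (by linarith)] at hy
    nlinarith [hy.1, hy.2]
  have hQpos : ∀ y ∈ Set.uIcc (-(1 - p)) (1 - p), 0 < Q y := fun y hy =>
    Real.sqrt_pos.2 (hpos y hy)
  have hQc : Continuous Q := by fun_prop
  have hFc : Continuous F := by fun_prop
  -- At both endpoints `Q = 1 + p`, so `t = y + Q y` runs from `2p = r` to `2`.
  have hQ1 : ∀ y, y ^ 2 = (1 - p) ^ 2 → Q y = 1 + p := fun y hy => by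
    rw [hQ]
    simp only [hy]
    rw [show 2 * (1 + p ^ 2) - (1 - p) ^ 2 = (1 + p) ^ 2 by ring]
    exact Real.sqrt_sq (by linarith)
  have hdc : ContinuousOn (fun y => y / Q y) (Set.uIcc (-(1 - p)) (1 - p)) :=
    continuousOn_id.div hQc.continuousOn fun y hy => (hQpos y hy).ne'
  have key := intervalIntegral.integral_comp_mul_deriv (a := -(1 - p)) (b := 1 - p)
    (f := fun y => y + Q y) (f' := fun y => 1 - y / Q y)
    (g := fun t => (t ^ 2 - r ^ 2) ^ ℓ * (1 - t ^ 2 / 4) ^ ℓ) ?_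
    (continuousOn_const.sub hdc) (by fun_prop)
  · rw [hQ1 _ (by ring), hQ1 _ rfl] at key
    rw [show (-(1 - p) + (1 + p)) = r by linarith, show (1 - p + (1 + p)) = 2 by ring] at key
    rw [← key]
    have hodd : ∫ y in -(1 - p)..(1 - p), F y * (y / Q y) = 0 := by
      refine intervalIntegral_eq_zero_of_odd (fun y => ?_) _
      simp only [hF, hQ, neg_sq]
      ring
    have hsplit : ∫ y in -(1 - p)..(1 - p), (F y - F y * (y / Q y)) =
        ∫ y in -(1 - p)..(1 - p), F y := by
      have hi : IntervalIntegrable (fun y => F y * (y / Q y)) volume (-(1 - p)) (1 - p) :=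
        (hFc.continuousOn.mul hdc).intervalIntegrable
      rw [intervalIntegral.integral_sub (hFc.intervalIntegrable _ _) hi, hodd, sub_zero]
    rw [← hsplit]
    refine intervalIntegral.integral_congr fun y hy => ?_
    have hsq : Q y ^ 2 = 2 * (1 + p ^ 2) - y ^ 2 := Real.sq_sqrt (hpos y hy).le
    -- The two bases are `2(1 - p² + yQ)` and `(1 - p² - yQ)/2`, with product `(1 - p²)² - y²Q²`.
    have hFy : ((y + Q y) ^ 2 - r ^ 2) ^ ℓ * (1 - (y + Q y) ^ 2 / 4) ^ ℓ = F y := by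
      rw [hF, ← mul_pow]
      congr 1
      have e : (y + Q y) ^ 2 = 2 * (1 + p ^ 2) + 2 * y * Q y := by linear_combination hsq
      rw [e, hrp]
      linear_combination (-y ^ 2) * hsq
    simp only [Function.comp_apply, hFy]
    ring
  · intro y hy
    have h1 : HasDerivAt (fun y : ℝ => 2 * (1 + p ^ 2) - y ^ 2) (-(2 * y)) y := by
      simpa using ((hasDerivAt_pow 2 y).const_sub (2 * (1 + p ^ 2)))
    refine ((hasDerivAt_id y).add (h1.sqrt (hpos y hy).ne')).congr_deriv ?_
    have := (hQpos y hy).ne'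
    simp only [hQ] at this ⊢
    field_simp
    ring

/-! ### Askey functions and the Wendland functions -/

/-- The `f`-form of the dilated Askey function `r ↦ (1 - r / 2)_+ ^ μ`. -/
noncomputable def askeyForm (μ x : ℝ) : ℝ := truncPow (1 - √(2 * x) / 2) μ

theorem askeyForm_eq_zero {μ : ℝ} (hμ : μ ≠ 0) (x : ℝ) (hx : 2 ≤ x) : askeyForm μ x = 0 := by
  have h : 2 ≤ √(2 * x) := Real.le_sqrt_of_sq_le (by linarith)
  rw [askeyForm, truncPow]
  split_ifs with h'
  · rw [show 1 - √(2 * x) / 2 = 0 by linarith, Real.zero_rpow hμ]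
  · rfl

theorem continuous_askeyForm {μ : ℝ} (hμ : 0 < μ) : Continuous (askeyForm μ) := by
  have : askeyForm μ = fun x => (max (1 - √(2 * x) / 2) 0) ^ μ := by
    funext x
    rw [askeyForm, truncPow]
    split_ifs with h
    · rw [max_eq_left h]
    · rw [max_eq_right (not_le.1 h).le, Real.zero_rpow hμ.ne']
  rw [this]
  exact Continuous.rpow_const (by fun_prop) fun _ => Or.inr hμ.le

theorem askeyForm_sq_div_two (μ : ℝ) {t : ℝ} (ht : 0 ≤ t) (ht2 : t ≤ 2) :
    askeyForm μ (t ^ 2 / 2) = (1 - t / 2) ^ μ := by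
  rw [askeyForm, truncPow, mul_div_cancel₀ _ two_ne_zero, Real.sqrt_sq ht, if_pos (by linarith)]

/-- For `α > 0`, substitute `x = 2t²`: the Jacobian `4t` supplies the weight `t`, and the kernel
becomes `(2(t² - r²))^(α - 1)`. -/
theorem fracIntegral_askeyForm {μ α : ℝ} (hμ : μ ≠ 0) (hα : 0 ≤ α) {r : ℝ} (hr : 0 ≤ r) :
    fracIntegral α (askeyForm μ) (2 * r ^ 2) = 4 ^ α * wendlandFunction μ α r := by
  rcases hα.eq_or_lt with rfl | hα
  · rw [fracIntegral, if_pos rfl, wendlandFunction, if_pos rfl, askeyForm, Real.rpow_zero,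
      one_mul, show 2 * (2 * r ^ 2) = (2 * r) ^ 2 by ring, Real.sqrt_sq (by positivity),
      mul_div_cancel_left₀ _ two_ne_zero]
  rw [fracIntegral_eq_Ioc hα.ne' (askeyForm_eq_zero hμ), wendlandFunction, if_neg hα.ne']
  have himg : Set.Ioc (2 * r ^ 2) 2 = (fun t : ℝ => 2 * t ^ 2) '' Set.Ioc r 1 := by
    ext x
    constructor
    · rintro ⟨h1, h2⟩
      have hx : 0 ≤ x / 2 := by nlinarith
      refine ⟨√(x / 2), ⟨Real.lt_sqrt_of_sq_lt (by linarith), ?_⟩, ?_⟩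
      · rw [Real.sqrt_le_left zero_le_one]
        linarith
      · simp only [Real.sq_sqrt hx]
        ring
    · rintro ⟨t, ⟨h1, h2⟩, rfl⟩
      constructor <;> dsimp only <;> nlinarith
  have hinj : Set.InjOn (fun t : ℝ => 2 * t ^ 2) (Set.Ioc r 1) := by
    intro x hx y hy hxy
    simp only at hxy
    have hx0 : 0 ≤ x := hr.trans hx.1.le
    have hy0 : 0 ≤ y := hr.trans hy.1.le
    exact (sq_eq_sq₀ hx0 hy0).1 (by linarith)
  rw [himg, integral_image_eq_integral_abs_deriv_smul measurableSet_Ioc (f' := fun t => 4 * t)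
    (fun t _ => ?_) hinj, ← integral_const_mul]
  · refine setIntegral_congr_fun measurableSet_Ioc fun t ht => ?_
    have ht0 : 0 < t := hr.trans_lt ht.1
    have hd : 0 ≤ t ^ 2 - r ^ 2 := by nlinarith [ht.1]
    have hΓ : Real.Gamma α ≠ 0 := (Real.Gamma_pos_of_pos hα).ne'
    have h2 : (2 : ℝ) ^ (α - 1) ≠ 0 := (Real.rpow_pos_of_pos two_pos _).ne'
    have h4 : (4 : ℝ) ^ α = 4 * (2 ^ (α - 1) * 2 ^ (α - 1)) := by
      rw [← Real.mul_rpow two_pos.le two_pos.le, Real.rpow_sub_one (by norm_num)]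
      norm_num
      ring
    simp only [smul_eq_mul]
    rw [show 2 * t ^ 2 = (2 * t) ^ 2 / 2 by ring,
      askeyForm_sq_div_two μ (by positivity) (by linarith [ht.2]),
      mul_div_cancel_left₀ _ two_ne_zero,
      show (2 * t) ^ 2 / 2 - 2 * r ^ 2 = 2 * (t ^ 2 - r ^ 2) by ring,
      Real.mul_rpow two_pos.le hd, abs_of_pos (by positivity), h4]
    field_simp
  · refine (((hasDerivAt_pow 2 t).const_mul 2).congr_deriv ?_).hasDerivWithinAt
    norm_num
    ring

/-! ### The highest derivative of the `f`-form of the convolution -/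

/-- The part of the final coefficient independent of `k`; the missing `4^(ℓ-k)` comes from
`fracIntegral_askeyForm`. -/
noncomputable def wuCoeff (ℓ n : ℕ) : ℝ :=
  2 ^ (ℓ + 1) * Real.Gamma ((ℓ : ℝ) + 1) *
    ((ℓ.choose n : ℝ) * (1 / ((ℓ : ℝ) + (n : ℝ) + 1)) * (2 : ℝ) ^ (ℓ - n) * (-1 : ℝ) ^ n)

/-- `(-1)^ℓ` times the derivative of order `ℓ` of the `f`-form of `f_ℓ * f_ℓ`. -/
noncomputable def wuProfile (ℓ : ℕ) (x : ℝ) : ℝ :=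
  ∑ n ∈ Finset.range (ℓ + 1), wuCoeff ℓ n * askeyForm ((ℓ : ℝ) + (n : ℝ) + 1) x

theorem continuous_wuProfile (ℓ : ℕ) : Continuous (wuProfile ℓ) :=
  continuous_finsetSum _ fun _ _ => continuous_const.mul (continuous_askeyForm (by positivity))

theorem wuProfile_eq_zero (ℓ : ℕ) (x : ℝ) (hx : 2 ≤ x) : wuProfile ℓ x = 0 :=
  Finset.sum_eq_zero fun n _ => by rw [askeyForm_eq_zero (by positivity) x hx, mul_zero]

/-- The polynomial with which `wuProfile ℓ` agrees in the variable `t = √(2 x)`. -/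
noncomputable def wuProfilePoly (ℓ : ℕ) (t : ℝ) : ℝ :=
  ∑ n ∈ Finset.range (ℓ + 1), wuCoeff ℓ n * (1 - t / 2) ^ (ℓ + n + 1)

theorem wuProfile_sq_div_two (ℓ : ℕ) {t : ℝ} (ht : 0 ≤ t) (ht2 : t ≤ 2) :
    wuProfile ℓ (t ^ 2 / 2) = wuProfilePoly ℓ t := by
  refine Finset.sum_congr rfl fun n _ => ?_
  rw [askeyForm_sq_div_two _ ht ht2, ← Real.rpow_natCast]
  push_cast
  rfl

theorem wuProfilePoly_two (ℓ : ℕ) : wuProfilePoly ℓ 2 = 0 :=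
  Finset.sum_eq_zero fun n _ => by simp

/-- With `u = 1 - t/2` one has `1 - t²/4 = u(2 - u)`; the binomial theorem for `(2 - u)^ℓ` matches
the derivative term by term. -/
theorem hasDerivAt_wuProfilePoly (ℓ : ℕ) (t : ℝ) :
    HasDerivAt (wuProfilePoly ℓ) (-(2 ^ ℓ * (ℓ.factorial : ℝ) * (1 - t ^ 2 / 4) ^ ℓ)) t := by
  have h1 : HasDerivAt (fun t : ℝ => 1 - t / 2) (-(1 / 2)) t :=
    ((hasDerivAt_id t).div_const 2).const_sub 1
  have h := HasDerivAt.fun_sum (u := Finset.range (ℓ + 1)) fun n _ =>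
    ((h1.fun_pow (ℓ + n + 1)).const_mul (wuCoeff ℓ n))
  refine h.congr_deriv ?_
  have hb : (1 - t ^ 2 / 4) ^ ℓ = (1 - t / 2) ^ ℓ * (-(1 - t / 2) + 2) ^ ℓ := by
    rw [← mul_pow]
    ring
  rw [hb, add_pow, Finset.mul_sum, Finset.mul_sum, ← Finset.sum_neg_distrib]
  refine Finset.sum_congr rfl fun n _ => ?_
  have hne : (ℓ : ℝ) + n + 1 ≠ 0 := by positivity
  rw [wuCoeff, Real.Gamma_nat_eq_factorial, neg_pow (1 - t / 2) n]
  simp only [Nat.add_sub_cancel]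
  push_cast
  field_simp
  ring

/-- After `x = t²/2`, integration by parts moves the derivative onto the profile. For `ℓ > 0` the
boundary terms vanish at `2` by the profile and at `r` by `(t² - r²)^ℓ`; for `ℓ = 0` this is the
fundamental theorem of calculus. -/
theorem fracIntegral_wuProfile (ℓ : ℕ) {r : ℝ} (hr : 0 ≤ r) (hr2 : r ≤ 2) :
    fracIntegral ℓ (wuProfile ℓ) (r ^ 2 / 2) =
      ∫ t in r..2, (t ^ 2 - r ^ 2) ^ ℓ * (1 - t ^ 2 / 4) ^ ℓ := by
  have hderiv := hasDerivAt_wuProfilePoly ℓ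
  have hcont : Continuous fun t : ℝ => -(2 ^ ℓ * (ℓ.factorial : ℝ) * (1 - t ^ 2 / 4) ^ ℓ) := by
    fun_prop
  rcases ℓ with _ | m
  · have h := intervalIntegral.integral_eq_sub_of_hasDerivAt (fun t _ => hderiv t)
      (hcont.intervalIntegrable r 2)
    rw [wuProfilePoly_two] at h
    simp only [fracIntegral, Nat.cast_zero, if_true, wuProfile_sq_div_two 0 hr hr2]
    simp at h ⊢
    linarith
  have hm : ((m + 1 : ℕ) : ℝ) ≠ 0 := by positivity
  have hle : r ^ 2 / 2 ≤ 2 := by nlinarith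
  rw [fracIntegral_eq_Ioc hm (wuProfile_eq_zero _), ← intervalIntegral.integral_of_le hle]
  have hpow : ∀ x : ℝ, (x - r ^ 2 / 2) ^ (((m + 1 : ℕ) : ℝ) - 1) = (x - r ^ 2 / 2) ^ m := by
    intro x
    push_cast
    rw [add_sub_cancel_right, Real.rpow_natCast]
  have hΓ : Real.Gamma ((m + 1 : ℕ) : ℝ) = m.factorial := by
    push_cast
    exact Real.Gamma_nat_eq_factorial m
  simp only [hpow, hΓ]
  have hc := continuous_wuProfile (m + 1)
  have hsub := intervalIntegral.integral_comp_mul_deriv (a := r) (b := 2)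
    (f := fun t => t ^ 2 / 2) (f' := fun t => t)
    (g := fun x => (x - r ^ 2 / 2) ^ m / m.factorial * wuProfile (m + 1) x)
    (fun t _ => by simpa using (hasDerivAt_pow 2 t).div_const 2) continuousOn_id (by fun_prop)
  rw [show (2 : ℝ) ^ 2 / 2 = 2 by norm_num] at hsub
  rw [← hsub]
  have hparts := intervalIntegral.integral_mul_deriv_eq_deriv_mul (a := r) (b := 2)
    (u := wuProfilePoly (m + 1)) (v := fun t => (t ^ 2 - r ^ 2) ^ (m + 1) /
      (2 ^ (m + 1) * (m + 1).factorial))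
    (v' := fun t => (t ^ 2 / 2 - r ^ 2 / 2) ^ m / m.factorial * t)
    (fun t _ => hderiv t) ?_ (hcont.intervalIntegrable _ _)
    (Continuous.intervalIntegrable (by fun_prop) _ _)
  · rw [wuProfilePoly_two] at hparts
    simp only [sub_self, zero_mul, ne_eq, Nat.succ_ne_zero, not_false_eq_true, zero_pow, zero_div,
      mul_zero, zero_sub, neg_mul, intervalIntegral.integral_neg, neg_neg] at hparts
    calc _ = _ := ?_
      _ = _ := hparts
      _ = _ := ?_
    · refine intervalIntegral.integral_congr fun t ht => ?_
      rw [Set.uIcc_of_le hr2] at ht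
      simp only [Function.comp_apply, wuProfile_sq_div_two (m + 1) (hr.trans ht.1) ht.2]
      ring
    · refine intervalIntegral.integral_congr fun t _ => ?_
      have : ((m + 1).factorial : ℝ) ≠ 0 := by positivity
      field_simp
  · intro t _
    have h1 := (((hasDerivAt_pow 2 t).sub_const (r ^ 2)).fun_pow (m + 1)).div_const
      ((2 : ℝ) ^ (m + 1) * (m + 1).factorial)
    refine h1.congr_deriv ?_
    rw [← sub_div, div_pow, Nat.factorial_succ]
    have : (m.factorial : ℝ) ≠ 0 := by positivity
    simp only [Nat.add_sub_cancel]
    push_cast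
    field_simp
    ring

/-- Writing `I_ℓ` as an iterated tail integral makes the derivatives required by `𝒟^k` explicit. -/
theorem fForm_wuBase_convolution (ℓ : ℕ) {s : ℝ} (hs : 0 ≤ s) :
    fForm (wuBase ℓ ⋆[ContinuousLinearMap.mul ℝ ℝ, volume] wuBase ℓ) s =
      (tailIntegral 2)^[ℓ] (wuProfile ℓ) s := by
  have hs' : s = √(2 * s) ^ 2 / 2 := by
    rw [Real.sq_sqrt (by positivity)]
    ring
  rw [fForm]
  rcases lt_or_ge 2 √(2 * s) with h | h
  · rw [wuBase_convolution_of_two_lt h,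
      iterate_tailIntegral_eq_zero (wuProfile_eq_zero ℓ) ℓ s (by nlinarith)]
  · rw [wuBase_convolution_eq_symm ℓ (Real.sqrt_nonneg _) h,
      integral_symm_eq_integral_tail ℓ (Real.sqrt_nonneg _) h,
      ← fracIntegral_wuProfile ℓ (Real.sqrt_nonneg _) h, ← hs',
      iterate_tailIntegral_eq_fracIntegral (continuous_wuProfile ℓ) (wuProfile_eq_zero ℓ)]

theorem theorem5p1 (ℓ : ℕ) (k : ℝ) (hk : ∃ m : ℕ, k = (m : ℝ) / 2) (hkℓ : k ≤ (ℓ : ℝ))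
    (r : ℝ) (hr : 0 ≤ r) :
    wuFunction (ℓ : ℝ) k (2 * r) =
      (2 : ℝ) ^ (3 * (ℓ : ℝ) - 2 * k + 1) * Real.Gamma ((ℓ : ℝ) + 1) *
        ∑ n ∈ Finset.range (ℓ + 1),
          (ℓ.choose n : ℝ) * (1 / ((ℓ : ℝ) + (n : ℝ) + 1)) * (2 : ℝ) ^ (ℓ - n) * (-1 : ℝ) ^ n *
            wendlandFunction ((ℓ : ℝ) + (n : ℝ) + 1) ((ℓ : ℝ) - k) r := by
  have hk0 : 0 ≤ k := by
    obtain ⟨m, rfl⟩ := hk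
    positivity
  have hpow : (2 : ℝ) ^ (3 * (ℓ : ℝ) - 2 * k + 1) = 2 ^ (ℓ + 1) * 4 ^ ((ℓ : ℝ) - k) := by
    rw [show (4 : ℝ) = 2 ^ (2 : ℝ) by norm_num, ← Real.rpow_mul two_pos.le,
      ← Real.rpow_natCast, ← Real.rpow_add two_pos]
    congr 1
    push_cast
    ring
  rw [wuFunction, dimWalkD, fFormInv, show (2 * r) ^ 2 / 2 = 2 * r ^ 2 by ring,
    fracOp_neg_eq_of_iterate_tailIntegral (continuous_wuProfile ℓ) (wuProfile_eq_zero ℓ)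
      (fun s hs => fForm_wuBase_convolution ℓ hs) hk0 hkℓ (by positivity)]
  have hsum := fracIntegral_sum (Finset.range (ℓ + 1)) (c := 2) (sub_nonneg.2 hkℓ) (wuCoeff ℓ)
    (g := fun n => askeyForm ((ℓ : ℝ) + (n : ℝ) + 1))
    (fun n _ => continuous_askeyForm (by positivity))
    (fun n _ => askeyForm_eq_zero (by positivity)) (2 * r ^ 2)
  refine hsum.trans ?_
  rw [hpow, Finset.mul_sum]
  refine Finset.sum_congr rfl fun n _ => ?_
  rw [fracIntegral_askeyForm (by positivity) (sub_nonneg.2 hkℓ) hr, wuCoeff]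
  ring
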